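/- Let $Q$ be a smooth finite-dimensional manifold (without boundary), $TQ$ its tangent bundle, $S$ the canonical tensor field on $TQ$ (in natural coordinates $S=\frac{\partial}{\partial v^i}\otimes dq^i$), $S^*$ its adjoint acting on covectors, and $\Delta=v^i\frac{\partial}{\partial v^i}$ the Liouville vector field. Let $L\colon TQ\to\mathbb R$ be a smooth regular Lagrangian, i.e. its fibre Hessian $\left(\frac{\partial^2L}{\partial v^i\partial v^j}\right)$ is everywhere nondegenerate. Put $\Theta_L=S^*(dL)$, $\omega_L=-d\Theta_L$ (a symplectic form), $E_L=\Delta(L)-L$, let $\Gamma_L$ be the Euler–Lagrange vector field, $i_{\Gamma_L}\omega_L=dE_L$, and let $\Lambda_L$ be the bivector $\Lambda_L(\alpha,\beta)=\omega_L(\hat\omega_L^{-1}\alpha,\hat\omega_L^{-1}\beta)$, where $\hat\omega_L(u)=i_u\omega_L$. Let $C\subset TQ$ be a smooth (possibly only immersed) submanifold, let $(TC)^0\subset T^*_C(TQ)$ be the annihilator of $TC$ and $TC^\perp\subset T_C(TQ)$ its $\omega_L$-orthogonal, and let $F=S^*((TC)^0)\subset T^*_C(TQ)$ be the Chetaev forces.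 A solution of the non-holonomic problem $(L,C)$ (with permitted directions $D=TC$ and reaction forces $F$) is a smooth vector field $\Gamma$ along $C$, tangent to $C$, such that $\Gamma\in\Gamma_L+\Lambda_L(F)$ at every point of $C$. Theorem. Assume that, at every point of $C$, $$\operatorname{rank}F=\operatorname{corank}TC$$ (equivalently, $S^*$ is injective on $(TC)^0$), and that $(L,C)$ is regular, i.e. $$S(TC^\perp)\cap TC=0 .$$ Then the non-holonomic problem $(L,C)$ has a unique solution $\Gamma$, and this solution is a second order differential equation (SODE): $S(\Gamma)=\Delta$ at every point of $C$. -/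

import Mathlib

open scoped Manifold ContDiff

noncomputable section

namespace NonHolonomic

section OneForms

variable {V : Type*} [NormedAddCommGroup V] [NormedSpace ℝ V]
  {H : Type*} [TopologicalSpace H] (I : ModelWithCorners ℝ V H)
  {M : Type*} [TopologicalSpace M] [ChartedSpace H M]

/-- The expression of the 1-form `θ` in the chart around `x`: the pullback of `θ` by the inverse
of that chart, a 1-form on (an open subset of) the model vector space. -/
def oneFormInChart (θ : ∀ y : M, TangentSpace I y →L[ℝ] ℝ) (x : M) (z : V) : V →L[ℝ] ℝ :=
  (θ ((extChartAt I x).symm z)).comp (mfderiv 𝓘(ℝ, V) I (extChartAt I x).symm z)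

/-- The exterior derivative of a 1-form in a vector space,
`dη (u, w) = (D_u η) w - (D_w η) u`. -/
def extDerivOneForm (η : V → V →L[ℝ] ℝ) (z : V) : LinearMap.BilinForm ℝ V :=
  LinearMap.mk₂ ℝ (fun u w => fderiv ℝ η z u w - fderiv ℝ η z w u)
    (fun u u' w => by simp only [map_add, add_apply]; ring)
    (fun c u w => by simp only [map_smul, smul_apply, smul_eq_mul]; ring)
    (fun u w w' => by simp only [map_add, add_apply]; ring)
    (fun c u w => by simp only [map_smul, smul_apply, smul_eq_mul]; ring)

/-- The exterior derivative `dθ` of a 1-form `θ` on a manifold, at the point `x`: the exterior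
derivative of its expression in the chart around `x`, pulled back to the tangent space at `x`. -/
def exteriorDeriv (θ : ∀ y : M, TangentSpace I y →L[ℝ] ℝ) (x : M) :
    LinearMap.BilinForm ℝ (TangentSpace I x) :=
  let T : TangentSpace I x →ₗ[ℝ] V := (mfderiv I 𝓘(ℝ, V) (extChartAt I x) x).toLinearMap
  (extDerivOneForm (oneFormInChart I θ x) (extChartAt I x x)).compl₁₂ T T

end OneForms

section TangentBundle

variable {E : Type*} [NormedAddCommGroup E] [NormedSpace ℝ E] [FiniteDimensional ℝ E]
  {Q : Type*} [TopologicalSpace Q] [ChartedSpace E Q] [IsManifold 𝓘(ℝ, E) ∞ Q]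

variable (E Q) in
/-- The velocity phase space `TQ` of the configuration manifold `Q`. -/
abbrev TQ := TangentBundle 𝓘(ℝ, E) Q

variable (E) in
/-- The model with corners (without boundary) of the manifold `TQ`. -/
abbrev IT : ModelWithCorners ℝ (E × E) (ModelProd E E) := 𝓘(ℝ, E).tangent

/-- The tangent space `T_x(TQ)`. -/
abbrev TTQ (x : TQ E Q) := TangentSpace (IT E) x

/-- The vertical lift at `x = (q, v) ∈ TQ` of `w ∈ T_q Q`: the derivative at `v` in the
direction `w` of the inclusion of the fibre `T_q Q` in `TQ`. -/
def verticalLift (x : TQ E Q) : TangentSpace 𝓘(ℝ, E) x.proj →L[ℝ] TTQ x :=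
  mfderiv 𝓘(ℝ, E) (IT E) (fun w : E => (⟨x.proj, w⟩ : TQ E Q)) x.snd

/-- The canonical tensor field `S = ∂/∂vⁱ ⊗ dqⁱ` on `TQ`: the vertical lift of the projection to
`TQ` of a tangent vector. -/
def S (x : TQ E Q) : TTQ x →L[ℝ] TTQ x :=
  (verticalLift x).comp (mfderiv (IT E) 𝓘(ℝ, E) (Bundle.TotalSpace.proj : TQ E Q → Q) x)

/-- The adjoint `S^*` of the canonical tensor field, acting on covectors. -/
def SStar (x : TQ E Q) : Module.Dual ℝ (TTQ x) →ₗ[ℝ] Module.Dual ℝ (TTQ x) :=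
  (S x).toLinearMap.dualMap

/-- The Liouville vector field `Δ = vⁱ ∂/∂vⁱ` on `TQ`. -/
def liouville (x : TQ E Q) : TTQ x := verticalLift x x.snd

/-- The differential of a function on `TQ`. -/
def diff (f : TQ E Q → ℝ) (x : TQ E Q) : TTQ x →L[ℝ] ℝ := mfderiv (IT E) 𝓘(ℝ, ℝ) f x

/-- The Lagrangian `L` is regular: its fibre Hessian `∂²L/∂vⁱ∂vʲ` is nondegenerate everywhere. -/
def IsRegularLagrangian (L : TQ E Q → ℝ) : Prop :=
  ∀ (q : Q) (v u : E),
    (∀ w : E, fderiv ℝ (fun z : E => fderiv ℝ (fun y : E => L ⟨q, y⟩) z) v u w = 0) → u = 0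

/-- The Poincaré–Cartan 1-form `Θ_L = S^*(dL)`. -/
def cartanOneForm (L : TQ E Q → ℝ) (x : TQ E Q) : TTQ x →L[ℝ] ℝ := (diff L x).comp (S x)

/-- The Cartan 2-form `ω_L = -dΘ_L`. -/
def cartanTwoForm (L : TQ E Q → ℝ) (x : TQ E Q) : LinearMap.BilinForm ℝ (TTQ x) :=
  -exteriorDeriv (IT E) (cartanOneForm L) x

/-- The energy `E_L = Δ(L) - L`. -/
def energy (L : TQ E Q → ℝ) (x : TQ E Q) : ℝ := diff L x (liouville x) - L x

instance (x : TQ E Q) : FiniteDimensional ℝ (TTQ x) :=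
  inferInstanceAs (FiniteDimensional ℝ (E × E))

open Classical in
/-- The inverse of the map `ω̂_L : T_x(TQ) → T_x^*(TQ)`, `ω̂_L(u) = ω_L(u, ·)`. (It is only used
for regular `L`, when `ω_L` is nondegenerate; otherwise it is set to zero.) -/
def cartanInv (L : TQ E Q → ℝ) (x : TQ E Q) : Module.Dual ℝ (TTQ x) →ₗ[ℝ] TTQ x :=
  if h : (cartanTwoForm L x).Nondegenerate then
    (LinearMap.BilinForm.toDual (cartanTwoForm L x) h).symm.toLinearMap
  else 0

/-- The Euler–Lagrange vector field `Γ_L`, defined by `i_{Γ_L} ω_L = dE_L`. -/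
def eulerLagrange (L : TQ E Q → ℝ) (x : TQ E Q) : TTQ x :=
  cartanInv L x (diff (energy L) x).toLinearMap

/-- The Poisson bivector `Λ_L(α, β) = ω_L(ω̂_L⁻¹ α, ω̂_L⁻¹ β)`. -/
def poisson (L : TQ E Q → ℝ) (x : TQ E Q) (α β : Module.Dual ℝ (TTQ x)) : ℝ :=
  cartanTwoForm L x (cartanInv L x α) (cartanInv L x β)

end TangentBundle

section Constraint

variable {E : Type*} [NormedAddCommGroup E] [NormedSpace ℝ E] [FiniteDimensional ℝ E]
  {Q : Type*} [TopologicalSpace Q] [ChartedSpace E Q] [IsManifold 𝓘(ℝ, E) ∞ Q]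
  {G : Type*} [NormedAddCommGroup G] [NormedSpace ℝ G]
  {C : Type*} [TopologicalSpace C] [ChartedSpace G C]

variable (G) in
/-- The manifold `C`, modelled on `G`, is a submanifold of `TQ` through the inclusion `ι`. -/
structure IsSubmanifold (ι : C → TQ E Q) : Prop where
  contMDiff : ContMDiff 𝓘(ℝ, G) (IT E) ∞ ι
  injective : Function.Injective ι
  immersion : ∀ c : C, Function.Injective (mfderiv 𝓘(ℝ, G) (IT E) ι c)

variable (G) in
/-- The tangent space `T_c C`, as a subspace of the tangent space of `TQ`. -/
def tangent (ι : C → TQ E Q) (c : C) : Submodule ℝ (TTQ (ι c)) :=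
  LinearMap.range (mfderiv 𝓘(ℝ, G) (IT E) ι c).toLinearMap

variable (G) in
/-- The symplectic orthogonal `TC^⊥` of `TC` with respect to `ω_L`. -/
def tangentPerp (L : TQ E Q → ℝ) (ι : C → TQ E Q) (c : C) : Submodule ℝ (TTQ (ι c)) where
  carrier := {u | ∀ w ∈ tangent G ι c, cartanTwoForm L (ι c) u w = 0}
  add_mem' := fun ha hb w hw => by
    rw [map_add, LinearMap.add_apply, ha w hw, hb w hw, add_zero]
  zero_mem' := fun w _ => by rw [map_zero, LinearMap.zero_apply]
  smul_mem' := fun r a ha w hw => by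
    rw [map_smul, LinearMap.smul_apply, ha w hw, smul_zero]

variable (G) in
/-- The distribution `S_C = S(TC^⊥)` along `C`. -/
def distributionS (L : TQ E Q → ℝ) (ι : C → TQ E Q) (c : C) : Submodule ℝ (TTQ (ι c)) :=
  (tangentPerp G L ι c).map (S (ι c)).toLinearMap

variable (G) in
/-- Regularity of the non-holonomic system `(L, C)`: `S(TC^⊥) ∩ TC = 0`. -/
def IsRegularSystem (L : TQ E Q → ℝ) (ι : C → TQ E Q) : Prop :=
  ∀ c : C, distributionS G L ι c ⊓ tangent G ι c = ⊥

variable (G) in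
/-- The Chetaev reaction forces `F = S^*((TC)^0)` along `C`. -/
def chetaevForces (ι : C → TQ E Q) (c : C) : Submodule ℝ (Module.Dual ℝ (TTQ (ι c))) :=
  (tangent G ι c).dualAnnihilator.map (SStar (ι c))

variable (G) in
/-- The rank of the Chetaev bundle equals the corank of `TC` in `T(TQ)`. -/
def HasFullRankForces (ι : C → TQ E Q) : Prop :=
  ∀ c : C, Module.finrank ℝ (chetaevForces G ι c) =
    Module.finrank ℝ (TTQ (ι c) ⧸ tangent G ι c)

variable (G) in
/-- `Γ` is a solution of the non-holonomic problem defined by `L`, `C`, the permitted directions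
`TC` and the Chetaev forces `F`: it is a smooth vector field along `C`, of the form
`Γ ∈ Γ_L + Λ_L(F)`, and tangent to `C`. -/
structure IsSolution (L : TQ E Q → ℝ) (ι : C → TQ E Q) (Γ : ∀ c : C, TTQ (ι c)) : Prop where
  smooth : ContMDiff 𝓘(ℝ, G) (IT E).tangent ∞
    (fun c => (⟨ι c, Γ c⟩ : TangentBundle (IT E) (TQ E Q)))
  dynamics : ∀ c : C, ∃ f ∈ chetaevForces G ι c, ∀ β : Module.Dual ℝ (TTQ (ι c)),
    β (Γ c) = β (eulerLagrange L (ι c)) + poisson L (ι c) f β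
  tangent : ∀ c : C, Γ c ∈ tangent G ι c

/-- The vector field `Γ` along `C` is a second order differential equation: `S(Γ) = Δ`. -/
def IsSODE (ι : C → TQ E Q) (Γ : ∀ c : C, TTQ (ι c)) : Prop :=
  ∀ c : C, S (ι c) (Γ c) = liouville (ι c)

end Constraint

end NonHolonomic

end

/-! Let A be the differential of the inclusion of C at a point. Tangency says Γ = A g, and a Chetaev
force is μ ∘ S with μ ∘ A = 0. Lowering indices with ω_L turns Γ ∈ Γ_L + Λ_L(F) into the Lagrange
multiplier system ω_L(A g, ·) + μ ∘ S = dE_L, μ ∘ A = 0 (`dynamics_iff_exists_multiplier`).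

In the unknowns (g, μ) this linear system is square, so it suffices to solve the homogeneous one
(`lagrangeSystem_injective`). Write μ = ω_L(m, ·); then μ ∘ A = 0 means m ∈ TC^⊥. Since ω_L(S u, w)
= -ω_L(u, S w), the first equation reads A g = S m, a vector of S(TC^⊥) ∩ TC = 0. Hence g = 0 and
S^*μ = 0, and the rank condition, which makes S^* injective on (TC)^0, gives μ = 0.

Smoothness (`contMDiff_of_multiplier`): in fixed charts the system is an invertible operator
depending smoothly on the point, and inversion of operators is smooth.

The SODE property (`S_eq_liouville_of_cartanTwoForm`): evaluate the first equation on S w. The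
multiplier drops out because S² = 0, and i_Δ ω_L = -S^*dE_L then gives ω_L(S Γ, ·) = ω_L(Δ, ·).

The identities for ω_L, S, Δ and E_L are read off in natural coordinates, where ω_L(u, w) = D²L(w, S
u) - D²L(u, S w). -/

noncomputable section

namespace NonHolonomic

/-! ### Linear algebra of the Lagrange multiplier system -/

section LinearAlgebra

variable {V G : Type*} [AddCommGroup V] [Module ℝ V] [FiniteDimensional ℝ V]
  [AddCommGroup G] [Module ℝ G]

/-- A linear map is injective on a subspace which it maps onto a subspace of the same dimension. -/
theorem eq_zero_of_finrank_map_eq {W : Type*} [AddCommGroup W] [Module ℝ W] (f : V →ₗ[ℝ] W)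
    (p : Submodule ℝ V) (h : Module.finrank ℝ (p.map f) = Module.finrank ℝ p)
    {v : V} (hv : v ∈ p) (hfv : f v = 0) : v = 0 := by
  have h1 := (f.domRestrict p).finrank_range_add_finrank_ker
  rw [LinearMap.range_domRestrict, h] at h1
  have h2 : LinearMap.ker (f.domRestrict p) = ⊥ :=
    Submodule.finrank_eq_zero.1 (by omega)
  have h3 : (⟨v, hv⟩ : p) ∈ LinearMap.ker (f.domRestrict p) := by simpa using hfv
  rw [h2, Submodule.mem_bot] at h3
  exact congrArg Subtype.val h3

/-- The homogeneous Lagrange multiplier system `Ω (A g) + μ ∘ S = 0`, `μ ∘ A = 0` of a regular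
constrained system has only the trivial solution. -/
theorem lagrangeSystem_injective (Ω : LinearMap.BilinForm ℝ V) (hΩ : Ω.Nondegenerate)
    (S : V →ₗ[ℝ] V) (hS : ∀ u w, Ω (S u) w = -Ω u (S w))
    (A : G →ₗ[ℝ] V) (hA : Function.Injective A)
    (hrank : Module.finrank ℝ ((LinearMap.range A).dualAnnihilator.map S.dualMap) =
      Module.finrank ℝ (V ⧸ LinearMap.range A))
    (hreg : ∀ u, (∀ w ∈ LinearMap.range A, Ω u w = 0) → S u ∈ LinearMap.range A → S u = 0)
    {g : G} {μ : Module.Dual ℝ V} (h1 : ∀ w, Ω (A g) w + μ (S w) = 0)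
    (h2 : ∀ g', μ (A g') = 0) : g = 0 ∧ μ = 0 := by
  -- Represent the multiplier by a vector: μ = Ω(m, ·), so that `h2` puts m in the orthogonal of the
  -- range of `A`.
  obtain ⟨m, rfl⟩ := (LinearMap.BilinForm.toDual Ω hΩ).surjective μ
  simp only [LinearMap.BilinForm.toDual_def] at h1 h2
  have h3 : A g = S m := by
    refine (LinearMap.BilinForm.toDual Ω hΩ).injective (LinearMap.ext fun w => ?_)
    simp only [LinearMap.BilinForm.toDual_def, hS]
    linarith [h1 w]
  have h4 : S m = 0 := hreg m (by rintro _ ⟨g', rfl⟩; exact h2 g') ⟨g, h3⟩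
  have hg : g = 0 := hA (by rw [h3, h4, map_zero])
  refine ⟨hg, eq_zero_of_finrank_map_eq S.dualMap (LinearMap.range A).dualAnnihilator ?_ ?_ ?_⟩
  -- The annihilator is dual to the quotient, so the rank condition says that `S.dualMap` preserves
  -- its dimension.
  · rw [hrank, ← (Submodule.dualQuotEquivDualAnnihilator (LinearMap.range A)).finrank_eq,
      Subspace.dual_finrank_eq]
  · rw [Submodule.mem_dualAnnihilator]
    rintro _ ⟨g', rfl⟩
    simpa [LinearMap.BilinForm.toDual_def] using h2 g'
  · ext w
    have := h1 w
    rw [hg, map_zero, map_zero, LinearMap.zero_apply, zero_add] at this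
    simpa [LinearMap.BilinForm.toDual_def] using this

/-- The Lagrange multiplier system `Ω (A g) + μ ∘ S = α`, `μ ∘ A = 0` of a regular constrained
system has a solution. -/
theorem exists_lagrangeSystem [FiniteDimensional ℝ G]
    (Ω : LinearMap.BilinForm ℝ V) (hΩ : Ω.Nondegenerate)
    (S : V →ₗ[ℝ] V) (hS : ∀ u w, Ω (S u) w = -Ω u (S w))
    (A : G →ₗ[ℝ] V) (hA : Function.Injective A)
    (hrank : Module.finrank ℝ ((LinearMap.range A).dualAnnihilator.map S.dualMap) =
      Module.finrank ℝ (V ⧸ LinearMap.range A))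
    (hreg : ∀ u, (∀ w ∈ LinearMap.range A, Ω u w = 0) → S u ∈ LinearMap.range A → S u = 0)
    (α : Module.Dual ℝ V) :
    ∃ (g : G) (μ : Module.Dual ℝ V), (∀ w, Ω (A g) w + μ (S w) = α w) ∧ ∀ g', μ (A g') = 0 := by
  let M : G × Module.Dual ℝ V →ₗ[ℝ] Module.Dual ℝ V × Module.Dual ℝ G :=
    ((Ω ∘ₗ A).coprod S.dualMap).prod (A.dualMap ∘ₗ LinearMap.snd ℝ G (Module.Dual ℝ V))
  have hinj : Function.Injective M := by
    rw [injective_iff_map_eq_zero]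
    rintro ⟨g, μ⟩ h
    obtain ⟨h1, h2⟩ := Prod.mk.inj h
    obtain ⟨rfl, rfl⟩ := lagrangeSystem_injective Ω hΩ S hS A hA hrank hreg
      (fun w => LinearMap.congr_fun h1 w) (fun g' => LinearMap.congr_fun h2 g')
    rfl
  have hdim : Module.finrank ℝ (G × Module.Dual ℝ V) =
      Module.finrank ℝ (Module.Dual ℝ V × Module.Dual ℝ G) := by
    rw [Module.finrank_prod, Module.finrank_prod, Subspace.dual_finrank_eq,
      Subspace.dual_finrank_eq, add_comm]
  obtain ⟨⟨g, μ⟩, h⟩ := (LinearMap.injective_iff_surjective_of_finrank_eq_finrank hdim).1 hinj (α, 0)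
  obtain ⟨h1, h2⟩ := Prod.mk.inj h
  exact ⟨g, μ, fun w => LinearMap.congr_fun h1 w, fun g' => LinearMap.congr_fun h2 g'⟩

end LinearAlgebra

/-! ### Chart independence of the exterior derivative of 1-forms -/

section ExteriorDerivative

variable {V : Type*} [NormedAddCommGroup V] [NormedSpace ℝ V]

theorem extDerivOneForm_apply (η : V → V →L[ℝ] ℝ) (z u w : V) :
    extDerivOneForm η z u w = fderiv ℝ η z u w - fderiv ℝ η z w u := rfl

/-- The exterior derivative of 1-forms commutes with pullbacks. -/
theorem extDerivOneForm_pullback {η : V → V →L[ℝ] ℝ} {τ : V → V} {z : V}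
    (hη : DifferentiableAt ℝ η (τ z)) (hτ : ContDiffAt ℝ 2 τ z) (u w : V) :
    extDerivOneForm (fun y => (η (τ y)).comp (fderiv ℝ τ y)) z u w =
      extDerivOneForm η (τ z) (fderiv ℝ τ z u) (fderiv ℝ τ z w) := by
  have h1 : DifferentiableAt ℝ τ z := hτ.differentiableAt (by norm_num)
  have h2 : DifferentiableAt ℝ (fderiv ℝ τ) z :=
    (hτ.fderiv_right (m := 1) (by norm_num)).differentiableAt (by norm_num)
  have h3 : HasFDerivAt (fun y => η (τ y)) ((fderiv ℝ η (τ z)).comp (fderiv ℝ τ z)) z :=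
    hη.hasFDerivAt.comp z h1.hasFDerivAt
  have h4 := (h3.clm_comp h2.hasFDerivAt).fderiv
  -- The terms containing the second derivative of τ cancel on antisymmetrising.
  have h5 : fderiv ℝ (fderiv ℝ τ) z u w = fderiv ℝ (fderiv ℝ τ) z w u :=
    (hτ.isSymmSndFDerivAt (by simp)).eq u w
  rw [extDerivOneForm_apply, extDerivOneForm_apply, h4]
  simp [h5]

theorem extDerivOneForm_congr {η η' : V → V →L[ℝ] ℝ} {z : V} (h : η =ᶠ[nhds z] η') :
    extDerivOneForm η z = extDerivOneForm η' z := by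
  ext u w
  rw [extDerivOneForm_apply, extDerivOneForm_apply, h.fderiv_eq]

variable {H : Type*} [TopologicalSpace H] (I : ModelWithCorners ℝ V H) [I.Boundaryless]
  {M : Type*} [TopologicalSpace M] [ChartedSpace H M]

/-- The expression of a 1-form in the chart around `x₀` determines the 1-form on the domain of
that chart. -/
theorem oneFormInChart_mfderiv [IsManifold I 1 M] (θ : ∀ y : M, TangentSpace I y →L[ℝ] ℝ)
    {x₀ x : M} (hx : x ∈ (extChartAt I x₀).source) (u : TangentSpace I x) :
    oneFormInChart I θ x₀ (extChartAt I x₀ x) (mfderiv I 𝓘(ℝ, V) (extChartAt I x₀) x u) = θ x u := by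
  obtain ⟨z, hz, rfl⟩ : ∃ z ∈ (extChartAt I x₀).target, (extChartAt I x₀).symm z = x :=
    ⟨_, (extChartAt I x₀).map_source hx, (extChartAt I x₀).left_inv hx⟩
  have h := mfderivWithin_extChartAt_symm_comp_mfderiv_extChartAt (I := I) hz
  rw [I.range_eq_univ, mfderivWithin_univ] at h
  rw [(extChartAt I x₀).right_inv hz]
  exact congrArg (θ _) (DFunLike.congr_fun h u)

theorem contDiffAt_extChartAt_comp_symm {n : ℕ∞ω} [IsManifold I n M] {x₀ x : M}
    (hx : x ∈ (extChartAt I x₀).source) :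
    ContDiffAt ℝ n (extChartAt I x₀ ∘ (extChartAt I x).symm) (extChartAt I x x) := by
  have h := contDiffWithinAt_ext_coord_change (I := I) (n := n) x₀ x (y := extChartAt I x x)
    (by simpa [PartialEquiv.trans_source] using hx)
  rwa [I.range_eq_univ, contDiffWithinAt_univ] at h

theorem mdifferentiableAt_extChartAt_symm [IsManifold I 1 M] {x : M} {z : V}
    (hz : z ∈ (extChartAt I x).target) :
    MDifferentiableAt 𝓘(ℝ, V) I (extChartAt I x).symm z := by
  have h := mdifferentiableWithinAt_extChartAt_symm (I := I) hz
  rwa [I.range_eq_univ, mdifferentiableWithinAt_univ] at h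

/-- The exterior derivative can be computed in any chart. -/
theorem exteriorDeriv_eq_of_mem_chart [IsManifold I 1 M] [IsManifold I 2 M]
    (θ : ∀ y : M, TangentSpace I y →L[ℝ] ℝ) {x₀ x : M}
    (hx : x ∈ (extChartAt I x₀).source)
    (hθ : DifferentiableAt ℝ (oneFormInChart I θ x₀) (extChartAt I x₀ x))
    (u w : TangentSpace I x) :
    exteriorDeriv I θ x u w = extDerivOneForm (oneFormInChart I θ x₀) (extChartAt I x₀ x)
      (mfderiv I 𝓘(ℝ, V) (extChartAt I x₀) x u) (mfderiv I 𝓘(ℝ, V) (extChartAt I x₀) x w) := by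
  set τ : V → V := extChartAt I x₀ ∘ (extChartAt I x).symm with hτdef
  set z := extChartAt I x x with hz
  have hzt : z ∈ (extChartAt I x).target := mem_extChartAt_target x
  have hτz : τ z = extChartAt I x₀ x := by simp [hτdef, hz]
  have hτs : ContDiffAt ℝ 2 τ z := contDiffAt_extChartAt_comp_symm I hx
  have hchain : ∀ y ∈ (extChartAt I x).target,
      (extChartAt I x).symm y ∈ (extChartAt I x₀).source →
      fderiv ℝ τ y = (mfderiv I 𝓘(ℝ, V) (extChartAt I x₀) ((extChartAt I x).symm y)).comp
        (mfderiv 𝓘(ℝ, V) I (extChartAt I x).symm y) := by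
    intro y hy hy'
    rw [← mfderiv_eq_fderiv]
    exact mfderiv_comp y (mdifferentiableAt_extChartAt (by rwa [← extChartAt_source I x₀]))
      (mdifferentiableAt_extChartAt_symm I hy)
  -- Near `z`, the two coordinate expressions of θ differ by pullback along the transition map τ.
  have hpull : oneFormInChart I θ x =ᶠ[nhds z]
      fun y => (oneFormInChart I θ x₀ (τ y)).comp (fderiv ℝ τ y) := by
    filter_upwards [extChartAt_target_mem_nhds (I := I) x,
      (continuousAt_extChartAt_symm (I := I) x).eventually
        (by rw [extChartAt_to_inv]; exact (isOpen_extChartAt_source x₀).mem_nhds hx)] with y hy hy'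
    rw [hchain y hy hy']
    ext v
    exact (oneFormInChart_mfderiv I θ hy' _).symm
  have hself : (mfderiv I 𝓘(ℝ, V) (extChartAt I x₀) x) =
      (fderiv ℝ τ (extChartAt I x x)).comp (mfderiv I 𝓘(ℝ, V) (extChartAt I x) x) := by
    have hτd : MDifferentiableAt 𝓘(ℝ, V) 𝓘(ℝ, V) τ (extChartAt I x x) :=
      (hτs.differentiableAt (by norm_num)).mdifferentiableAt
    have hcomp : mfderiv I 𝓘(ℝ, V) (τ ∘ extChartAt I x) x =
        (mfderiv 𝓘(ℝ, V) 𝓘(ℝ, V) τ (extChartAt I x x)).comp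
          (mfderiv I 𝓘(ℝ, V) (extChartAt I x) x) :=
      mfderiv_comp x hτd (mdifferentiableAt_extChartAt (mem_chart_source H x))
    rw [mfderiv_eq_fderiv] at hcomp
    have hEq : extChartAt I x₀ =ᶠ[nhds x] τ ∘ extChartAt I x := by
      filter_upwards [extChartAt_source_mem_nhds (I := I) x] with y hy
      exact congrArg (extChartAt I x₀) ((extChartAt I x).left_inv hy).symm
    exact hEq.mfderiv_eq.trans hcomp
  have h := extDerivOneForm_pullback (by rwa [hτz]) hτs (mfderiv I 𝓘(ℝ, V) (extChartAt I x) x u)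
    (mfderiv I 𝓘(ℝ, V) (extChartAt I x) x w)
  rw [← extDerivOneForm_congr hpull, hτz] at h
  rw [hself]
  exact h

end ExteriorDerivative

/-! ### Natural coordinates on the tangent bundle -/

section VelocityCharts

variable {E : Type*} [NormedAddCommGroup E] [NormedSpace ℝ E]
  {Q : Type*} [TopologicalSpace Q] [ChartedSpace E Q] [IsManifold 𝓘(ℝ, E) ∞ Q]

/-- The derivative at `x` of the natural chart around `x₀`. -/
def chartDeriv (x₀ x : TQ E Q) : TTQ x →L[ℝ] E × E :=
  mfderiv (IT E) 𝓘(ℝ, E × E) (extChartAt (IT E) x₀) x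

/-- The derivative at `q` of the chart of `Q` around `q₀`. -/
def baseChartDeriv (q₀ q : Q) : E →L[ℝ] E :=
  mfderiv 𝓘(ℝ, E) 𝓘(ℝ, E) (extChartAt 𝓘(ℝ, E) q₀) q

theorem mem_extChartAt_source_iff {x₀ x : TQ E Q} :
    x ∈ (extChartAt (IT E) x₀).source ↔ x.proj ∈ (chartAt E x₀.proj).source := by
  rw [extChartAt_source, TangentBundle.mem_chart_source_iff]

/-- The trivialisations of the tangent bundle are the derivatives of the base charts, so the charts
of TQ are the natural coordinates (q, v), linear on fibres. The coordinate forms of S and Δ rest on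
this. -/
theorem extChartAt_apply {x₀ : TQ E Q} {q : Q} (w : E)
    (hx : q ∈ (chartAt E x₀.proj).source) :
    extChartAt (IT E) x₀ ⟨q, w⟩ =
      (extChartAt 𝓘(ℝ, E) x₀.proj q, baseChartDeriv x₀.proj q w) := by
  rw [FiberBundle.extChartAt]
  refine Prod.ext ?_ ?_
  · simp [TangentBundle.trivializationAt_apply]
  · refine Eq.trans ?_ (DFunLike.congr_fun
      (TangentBundle.continuousLinearMapAt_trivializationAt (I := 𝓘(ℝ, E)) hx) w)
    exact (congrFun (Bundle.Trivialization.coe_linearMapAt_of_mem (R := ℝ)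
      (trivializationAt E (TangentSpace 𝓘(ℝ, E) : Q → Type _) x₀.proj) hx) w).symm

/-- Fibres are identified with `E` through the preferred chart at their base point;
`fibreHessian_eq` relies on this to compare raw fibre derivatives with coordinate ones. -/
theorem baseChartDeriv_self (q : Q) : baseChartDeriv q q = ContinuousLinearMap.id ℝ E :=
  mfderiv_extChartAt_self

theorem chartDeriv_bijective {x₀ x : TQ E Q} (hx : x ∈ (extChartAt (IT E) x₀).source) :
    Function.Bijective (chartDeriv x₀ x) :=
  (isInvertible_mfderiv_extChartAt (I := IT E) hx).bijective

theorem mdifferentiableAt_fibreInclusion (q : Q) (v : E) :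
    MDifferentiableAt 𝓘(ℝ, E) (IT E) (fun w : E => (⟨q, w⟩ : TQ E Q)) v := by
  refine ContMDiffAt.mdifferentiableAt (n := 1) ?_ (by norm_num)
  refine Bundle.contMDiffAt_totalSpace.2 ⟨contMDiffAt_const, ?_⟩
  refine (baseChartDeriv q q).contDiff.contDiffAt.contMDiffAt.congr_of_eventuallyEq ?_
  exact Filter.Eventually.of_forall fun w =>
    congrArg Prod.snd (extChartAt_apply (x₀ := ⟨q, v⟩) w (mem_chart_source E q))

theorem chartDeriv_verticalLift {x₀ x : TQ E Q} (hx : x ∈ (extChartAt (IT E) x₀).source) (w : E) :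
    chartDeriv x₀ x (verticalLift x w) = ((0 : E), baseChartDeriv x₀.proj x.proj w) := by
  have hx' := mem_extChartAt_source_iff.1 hx
  let v : E := x.snd
  let i : E → TQ E Q := fun w => ⟨x.proj, w⟩
  have hφi : extChartAt (IT E) x₀ ∘ i =
      fun w => (extChartAt 𝓘(ℝ, E) x₀.proj x.proj, baseChartDeriv x₀.proj x.proj w) :=
    funext fun w => extChartAt_apply w hx'
  have hφ : MDifferentiableAt (IT E) 𝓘(ℝ, E × E) (extChartAt (IT E) x₀) (i v) :=
    mdifferentiableAt_extChartAt (by rwa [extChartAt_source] at hx)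
  have hid : MDifferentiableAt 𝓘(ℝ, E) (IT E) i v := mdifferentiableAt_fibreInclusion x.proj v
  have h : mfderiv 𝓘(ℝ, E) 𝓘(ℝ, E × E) (extChartAt (IT E) x₀ ∘ i) v w =
      chartDeriv x₀ x (verticalLift x w) := mfderiv_comp_apply v hφ hid w
  rw [mfderiv_eq_fderiv, hφi] at h
  have h2 : HasFDerivAt (fun w : E => (extChartAt 𝓘(ℝ, E) x₀.proj x.proj,
      baseChartDeriv x₀.proj x.proj w)) ((0 : E →L[ℝ] E).prod (baseChartDeriv x₀.proj x.proj))
      v := (hasFDerivAt_const (𝕜 := ℝ) (E := E) _ v).prodMk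
        ((baseChartDeriv x₀.proj x.proj).hasFDerivAt (x := v))
  exact h.symm.trans (DFunLike.congr_fun h2.fderiv w)

/-- In natural coordinates the projection to Q is the first component; differentiate this identity.
-/
theorem chartDeriv_fst {x₀ x : TQ E Q} (hx : x ∈ (extChartAt (IT E) x₀).source) (u : TTQ x) :
    (chartDeriv x₀ x u).1 = baseChartDeriv (E := E) x₀.proj x.proj
      (mfderiv (IT E) 𝓘(ℝ, E) (Bundle.TotalSpace.proj : TQ E Q → Q) x u) := by
  have hx' := mem_extChartAt_source_iff.1 hx
  have hπ : MDifferentiableAt (IT E) 𝓘(ℝ, E) (Bundle.TotalSpace.proj : TQ E Q → Q) x :=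
    (Bundle.contMDiffAt_proj (TangentSpace 𝓘(ℝ, E) : Q → Type _) (n := 1)).mdifferentiableAt
      (by norm_num)
  have hψ : MDifferentiableAt 𝓘(ℝ, E) 𝓘(ℝ, E) (extChartAt 𝓘(ℝ, E) x₀.proj) x.proj :=
    mdifferentiableAt_extChartAt hx'
  have h1 := mfderiv_comp_apply x hψ hπ u
  have hφ : MDifferentiableAt (IT E) 𝓘(ℝ, E × E) (extChartAt (IT E) x₀) x :=
    mdifferentiableAt_extChartAt (by rwa [extChartAt_source] at hx)
  have hfst : MDifferentiableAt 𝓘(ℝ, E × E) 𝓘(ℝ, E) (Prod.fst : E × E → E)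
    (extChartAt (IT E) x₀ x) := differentiableAt_fst.mdifferentiableAt
  have h2 := mfderiv_comp_apply x hfst hφ u
  have hEq : (extChartAt 𝓘(ℝ, E) x₀.proj ∘ (Bundle.TotalSpace.proj : TQ E Q → Q)) =ᶠ[nhds x]
      (Prod.fst ∘ extChartAt (IT E) x₀) := by
    filter_upwards [(isOpen_extChartAt_source (I := IT E) x₀).mem_nhds hx] with y hy
    exact (congrArg Prod.fst (extChartAt_apply (E := E) y.snd
      (mem_extChartAt_source_iff.1 hy))).symm
  rw [mfderiv_eq_fderiv, fderiv_fst] at h2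
  exact h2.symm.trans ((DFunLike.congr_fun hEq.mfderiv_eq u).symm.trans h1)

theorem chartDeriv_S {x₀ x : TQ E Q} (hx : x ∈ (extChartAt (IT E) x₀).source) (u : TTQ x) :
    chartDeriv x₀ x (S x u) = ((0 : E), (chartDeriv x₀ x u).1) := by
  exact (chartDeriv_verticalLift (E := E) hx _).trans (Prod.ext rfl (chartDeriv_fst hx u).symm)

theorem chartDeriv_liouville {x₀ x : TQ E Q} (hx : x ∈ (extChartAt (IT E) x₀).source) :
    chartDeriv x₀ x (liouville x) = ((0 : E), (extChartAt (IT E) x₀ x).2) := by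
  have h : extChartAt (IT E) x₀ x = _ :=
    extChartAt_apply (E := E) x.snd (mem_extChartAt_source_iff.1 hx)
  rw [h]
  exact chartDeriv_verticalLift (E := E) hx _

end VelocityCharts

/-! ### The Cartan form, the energy and the SODE identity in coordinates -/

section LagrangianInCharts

variable {E : Type*} [NormedAddCommGroup E] [NormedSpace ℝ E]
  {Q : Type*} [TopologicalSpace Q] [ChartedSpace E Q] [IsManifold 𝓘(ℝ, E) ∞ Q]

/-- The expression of a function on `TQ` in the natural chart around `x₀`. -/
def inChart (L : TQ E Q → ℝ) (x₀ : TQ E Q) : E × E → ℝ := L ∘ (extChartAt (IT E) x₀).symm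

variable (E) in
/-- The canonical tensor field in coordinates. -/
def verticalEndo : E × E →L[ℝ] E × E :=
  (ContinuousLinearMap.inr ℝ E E).comp (ContinuousLinearMap.fst ℝ E E)

@[simp]
theorem verticalEndo_apply (u : E × E) : verticalEndo E u = (0, u.1) := rfl

/-- The Cartan 2-form in coordinates. -/
def twoFormInChart (L : TQ E Q → ℝ) (x₀ : TQ E Q) (z u w : E × E) : ℝ :=
  fderiv ℝ (fderiv ℝ (inChart L x₀)) z w (verticalEndo E u) -
    fderiv ℝ (fderiv ℝ (inChart L x₀)) z u (verticalEndo E w)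

/-- The energy in coordinates. -/
def energyInChart (L : TQ E Q → ℝ) (x₀ : TQ E Q) (z : E × E) : ℝ :=
  fderiv ℝ (inChart L x₀) z (0, z.2) - inChart L x₀ z

variable {L : TQ E Q → ℝ} {x₀ x : TQ E Q} {z : E × E}

theorem contDiffAt_inChart (hL : ContMDiff (IT E) 𝓘(ℝ, ℝ) ∞ L)
    (hz : z ∈ (extChartAt (IT E) x₀).target) : ContDiffAt ℝ ∞ (inChart L x₀) z := by
  rw [← contMDiffAt_iff_contDiffAt]
  exact hL.contMDiffAt.comp z ((contMDiffOn_extChartAt_symm x₀).contMDiffAt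
    ((isOpen_extChartAt_target x₀).mem_nhds hz))

theorem contDiffAt_fderiv_inChart (hL : ContMDiff (IT E) 𝓘(ℝ, ℝ) ∞ L)
    (hz : z ∈ (extChartAt (IT E) x₀).target) : ContDiffAt ℝ ∞ (fderiv ℝ (inChart L x₀)) z :=
  (contDiffAt_inChart hL hz).fderiv_right (by simp)

theorem diff_of_eventuallyEq {f : TQ E Q → ℝ} {g : E × E → ℝ}
    (hx : x ∈ (extChartAt (IT E) x₀).source)
    (hfg : f =ᶠ[nhds x] g ∘ extChartAt (IT E) x₀)
    (hg : DifferentiableAt ℝ g (extChartAt (IT E) x₀ x)) (u : TTQ x) :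
    diff f x u = fderiv ℝ g (extChartAt (IT E) x₀ x) (chartDeriv x₀ x u) := by
  have hφ : MDifferentiableAt (IT E) 𝓘(ℝ, E × E) (extChartAt (IT E) x₀) x :=
    mdifferentiableAt_extChartAt (by rwa [extChartAt_source] at hx)
  have h := mfderiv_comp_apply x hg.mdifferentiableAt hφ u
  rw [mfderiv_eq_fderiv] at h
  exact (DFunLike.congr_fun hfg.mfderiv_eq u).trans h

theorem diff_eq (hL : ContMDiff (IT E) 𝓘(ℝ, ℝ) ∞ L)
    (hx : x ∈ (extChartAt (IT E) x₀).source) (u : TTQ x) :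
    diff L x u = fderiv ℝ (inChart L x₀) (extChartAt (IT E) x₀ x) (chartDeriv x₀ x u) := by
  refine diff_of_eventuallyEq hx ?_
    ((contDiffAt_inChart hL ((extChartAt (IT E) x₀).map_source hx)).differentiableAt (by simp)) u
  filter_upwards [(isOpen_extChartAt_source (I := IT E) x₀).mem_nhds hx] with y hy
  exact congrArg L ((extChartAt (IT E) x₀).left_inv hy).symm

theorem oneFormInChart_cartanOneForm (hL : ContMDiff (IT E) 𝓘(ℝ, ℝ) ∞ L)
    (hz : z ∈ (extChartAt (IT E) x₀).target) :
    oneFormInChart (IT E) (cartanOneForm L) x₀ z =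
      (fderiv ℝ (inChart L x₀) z).comp (verticalEndo E) := by
  obtain ⟨x, hx, rfl⟩ : ∃ x ∈ (extChartAt (IT E) x₀).source, extChartAt (IT E) x₀ x = z :=
    ⟨_, (extChartAt (IT E) x₀).map_target hz, (extChartAt (IT E) x₀).right_inv hz⟩
  refine ContinuousLinearMap.ext fun u => ?_
  obtain ⟨u, rfl⟩ := (chartDeriv_bijective hx).2 u
  refine (oneFormInChart_mfderiv (IT E) (cartanOneForm L) hx u).trans ?_
  refine (diff_eq hL hx (S x u)).trans ?_
  rw [chartDeriv_S hx]
  rfl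

/-- Any chart containing `x` is allowed, not only the preferred one at `x`: smooth dependence on the
point has to be read in a fixed chart. -/
theorem cartanTwoForm_eq (hL : ContMDiff (IT E) 𝓘(ℝ, ℝ) ∞ L)
    (hx : x ∈ (extChartAt (IT E) x₀).source) (u w : TTQ x) :
    cartanTwoForm L x u w = twoFormInChart L x₀ (extChartAt (IT E) x₀ x)
      (chartDeriv x₀ x u) (chartDeriv x₀ x w) := by
  have hz := (extChartAt (IT E) x₀).map_source hx
  have hη : oneFormInChart (IT E) (cartanOneForm L) x₀ =ᶠ[nhds (extChartAt (IT E) x₀ x)]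
      fun z => (fderiv ℝ (inChart L x₀) z).comp (verticalEndo E) := by
    filter_upwards [(isOpen_extChartAt_target (I := IT E) x₀).mem_nhds hz] with z hz
    exact oneFormInChart_cartanOneForm hL hz
  have hd := ((contDiffAt_fderiv_inChart hL hz).differentiableAt (by simp)).hasFDerivAt.clm_comp
    (hasFDerivAt_const (verticalEndo E) _)
  have h := exteriorDeriv_eq_of_mem_chart (IT E) (cartanOneForm L) hx
    (hd.differentiableAt.congr_of_eventuallyEq hη) u w
  have h2 : cartanTwoForm L x u w = -exteriorDeriv (IT E) (cartanOneForm L) x u w := rfl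
  have h3 (u w : E × E) : extDerivOneForm (oneFormInChart (IT E) (cartanOneForm L) x₀)
      (extChartAt (IT E) x₀ x) u w = -twoFormInChart L x₀ (extChartAt (IT E) x₀ x) u w := by
    rw [extDerivOneForm_congr hη, extDerivOneForm_apply, hd.fderiv]
    simp [twoFormInChart]
  rw [h2, h]
  exact (congrArg Neg.neg (h3 _ _)).trans (neg_neg _)

theorem contDiffAt_energyInChart (hL : ContMDiff (IT E) 𝓘(ℝ, ℝ) ∞ L)
    (hz : z ∈ (extChartAt (IT E) x₀).target) : ContDiffAt ℝ ∞ (energyInChart L x₀) z :=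
  ((contDiffAt_fderiv_inChart hL hz).clm_apply (contDiffAt_const.prodMk contDiffAt_snd)).sub
    (contDiffAt_inChart hL hz)

theorem diff_energy_eq (hL : ContMDiff (IT E) 𝓘(ℝ, ℝ) ∞ L)
    (hx : x ∈ (extChartAt (IT E) x₀).source) (u : TTQ x) :
    diff (energy L) x u =
      fderiv ℝ (energyInChart L x₀) (extChartAt (IT E) x₀ x) (chartDeriv x₀ x u) := by
  refine diff_of_eventuallyEq hx ?_ ((contDiffAt_energyInChart hL
    ((extChartAt (IT E) x₀).map_source hx)).differentiableAt (by simp)) u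
  filter_upwards [(isOpen_extChartAt_source (I := IT E) x₀).mem_nhds hx] with y hy
  have h1 := diff_eq hL hy (liouville y)
  rw [chartDeriv_liouville hy] at h1
  exact congrArg₂ (· - ·) h1 (congrArg L ((extChartAt (IT E) x₀).left_inv hy).symm)

theorem fderiv_energyInChart (hL : ContMDiff (IT E) 𝓘(ℝ, ℝ) ∞ L)
    (hz : z ∈ (extChartAt (IT E) x₀).target) (u : E × E) :
    fderiv ℝ (energyInChart L x₀) z u = fderiv ℝ (fderiv ℝ (inChart L x₀)) z u (0, z.2) +
      fderiv ℝ (inChart L x₀) z (0, u.2) - fderiv ℝ (inChart L x₀) z u := by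
  have h1 := ((contDiffAt_fderiv_inChart hL hz).differentiableAt (by simp)).hasFDerivAt
  have h2 := ((contDiffAt_inChart hL hz).differentiableAt (by simp)).hasFDerivAt
  have h3 : HasFDerivAt (fun z : E × E => ((0 : E), z.2))
      ((ContinuousLinearMap.inr ℝ E E).comp (ContinuousLinearMap.snd ℝ E E)) z :=
    ((ContinuousLinearMap.inr ℝ E E).comp (ContinuousLinearMap.snd ℝ E E)).hasFDerivAt
  have h4 := ((h1.clm_apply h3).sub h2).fderiv
  refine (DFunLike.congr_fun h4 u).trans ?_
  simp
  ring

theorem fderiv_fderiv_inChart_symm (hL : ContMDiff (IT E) 𝓘(ℝ, ℝ) ∞ L)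
    (hz : z ∈ (extChartAt (IT E) x₀).target) (u w : E × E) :
    fderiv ℝ (fderiv ℝ (inChart L x₀)) z u w = fderiv ℝ (fderiv ℝ (inChart L x₀)) z w u :=
  ((contDiffAt_inChart hL hz).isSymmSndFDerivAt
    (by rw [minSmoothness_of_isRCLikeNormedField]; exact WithTop.coe_le_coe.2 le_top)).eq u w

/-- In the chart centred over `q`, the fibre over `q` is the slice y ↦ (c, y) with no linear change
of variable, so the chain rule only inserts the inclusion of the second factor. -/
theorem fibreHessian_eq (hL : ContMDiff (IT E) 𝓘(ℝ, ℝ) ∞ L) (q : Q) (v u w : E) :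
    fderiv ℝ (fun z : E => fderiv ℝ (fun y : E => L ⟨q, y⟩) z) v u w =
      fderiv ℝ (fderiv ℝ (inChart L ⟨q, v⟩)) (extChartAt (IT E) (⟨q, v⟩ : TQ E Q) ⟨q, v⟩)
        (0, u) (0, w) := by
  set x : TQ E Q := ⟨q, v⟩
  set c := extChartAt 𝓘(ℝ, E) q q
  have hφ (y : E) : extChartAt (IT E) x ⟨q, y⟩ = (c, y) := by
    rw [extChartAt_apply y (mem_chart_source E q), baseChartDeriv_self]
    rfl
  have hsrc (y : E) : (⟨q, y⟩ : TQ E Q) ∈ (extChartAt (IT E) x).source :=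
    mem_extChartAt_source_iff.2 (mem_chart_source E q)
  have ht (y : E) : (c, y) ∈ (extChartAt (IT E) x).target :=
    hφ y ▸ (extChartAt (IT E) x).map_source (hsrc y)
  have hLy : (fun y : E => L ⟨q, y⟩) = fun y => inChart L x (c, y) := by
    funext y
    rw [← hφ y]
    exact congrArg L ((extChartAt (IT E) x).left_inv (hsrc y)).symm
  have hincl (y : E) : HasFDerivAt (fun y : E => (c, y)) (ContinuousLinearMap.inr ℝ E E) y :=
    hasFDerivAt_prodMk_right c y
  have h1 : (fun z : E => fderiv ℝ (fun y : E => L ⟨q, y⟩) z) =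
      fun y => (fderiv ℝ (inChart L x) (c, y)).comp (ContinuousLinearMap.inr ℝ E E) := by
    funext y
    rw [hLy]
    exact (((contDiffAt_inChart hL (ht y)).differentiableAt (by simp)).hasFDerivAt.comp y
      (hincl y)).fderiv
  have h2 : HasFDerivAt (fun y => fderiv ℝ (inChart L x) (c, y))
      ((fderiv ℝ (fderiv ℝ (inChart L x)) (c, v)).comp (ContinuousLinearMap.inr ℝ E E)) v :=
    ((contDiffAt_fderiv_inChart hL (ht v)).differentiableAt (by simp)).hasFDerivAt.comp v (hincl v)
  rw [h1, (h2.clm_comp (hasFDerivAt_const _ v)).fderiv, hφ v]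
  simp

theorem cartanTwoForm_neg (hL : ContMDiff (IT E) 𝓘(ℝ, ℝ) ∞ L) (x : TQ E Q) (u w : TTQ x) :
    cartanTwoForm L x u w = -cartanTwoForm L x w u := by
  rw [cartanTwoForm_eq hL (mem_extChartAt_source x), cartanTwoForm_eq hL (mem_extChartAt_source x),
    twoFormInChart, twoFormInChart, neg_sub]

/-- Because S² = 0 and D²L is symmetric, both sides reduce to -D²L(S u, S w). -/
theorem cartanTwoForm_S (hL : ContMDiff (IT E) 𝓘(ℝ, ℝ) ∞ L) (x : TQ E Q) (u w : TTQ x) :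
    cartanTwoForm L x (S x u) w = -cartanTwoForm L x u (S x w) := by
  have hx := mem_extChartAt_source (I := IT E) x
  rw [cartanTwoForm_eq hL hx, cartanTwoForm_eq hL hx, chartDeriv_S hx, chartDeriv_S hx,
    twoFormInChart, twoFormInChart,
    fderiv_fderiv_inChart_symm hL (mem_extChartAt_target x) (0, (chartDeriv x x w).1)]
  simp [show ((0 : E), (0 : E)) = 0 from rfl]

theorem S_S (x : TQ E Q) (u : TTQ x) : S x (S x u) = 0 := by
  have hx := mem_extChartAt_source (I := IT E) x
  apply (chartDeriv_bijective hx).1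
  rw [chartDeriv_S hx, chartDeriv_S hx, map_zero]
  rfl

/-- Both sides are -D²L(Δ, S w): Δ is vertical, and the first-order terms of dE_L cancel on vertical
vectors. -/
theorem cartanTwoForm_liouville (hL : ContMDiff (IT E) 𝓘(ℝ, ℝ) ∞ L) (x : TQ E Q) (w : TTQ x) :
    cartanTwoForm L x (liouville x) w = -diff (energy L) x (S x w) := by
  have hx := mem_extChartAt_source (I := IT E) x
  have hz := mem_extChartAt_target (I := IT E) x
  rw [cartanTwoForm_eq hL hx, diff_energy_eq hL hx, fderiv_energyInChart hL hz,
    chartDeriv_liouville hx, chartDeriv_S hx, twoFormInChart, fderiv_fderiv_inChart_symm hL hz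
    (0, (extChartAt (IT E) x x).2)]
  simp [show ((0 : E), (0 : E)) = 0 from rfl]

theorem cartanTwoForm_nondegenerate (hL : ContMDiff (IT E) 𝓘(ℝ, ℝ) ∞ L)
    (hLreg : IsRegularLagrangian L) (x : TQ E Q) : (cartanTwoForm L x).Nondegenerate := by
  have hx := mem_extChartAt_source (I := IT E) x
  have hz := mem_extChartAt_target (I := IT E) x
  have hreg (u : E) (h : ∀ w : E, fderiv ℝ (fderiv ℝ (inChart L x)) (extChartAt (IT E) x x)
      (0, u) (0, w) = 0) : u = 0 :=
    hLreg x.proj x.snd u fun w => (fibreHessian_eq hL x.proj x.snd u w).trans (h w)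
  have hleft (u : TTQ x) (h : ∀ w, cartanTwoForm L x u w = 0) : u = 0 := by
    have h' (w : E × E) : twoFormInChart L x (extChartAt (IT E) x x) (chartDeriv x x u) w = 0 := by
      obtain ⟨w, rfl⟩ := (chartDeriv_bijective hx).2 w
      rw [← cartanTwoForm_eq hL hx]
      exact h w
    -- Pairing with vertical vectors sees only the horizontal component of `u`, through the fibre
    -- Hessian.
    have h1 : (chartDeriv x x u).1 = 0 := hreg _ fun w => by
      have := h' (0, w)
      rw [fderiv_fderiv_inChart_symm hL hz]
      simpa [twoFormInChart, show ((0 : E), (0 : E)) = 0 from rfl] using this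
    -- Now `u` is vertical, and pairing with (w, 0) gives minus the fibre Hessian of its second
    -- component.
    have h2 : (chartDeriv x x u).2 = 0 := hreg _ fun w => by
      have := h' (w, 0)
      rw [twoFormInChart, verticalEndo_apply, verticalEndo_apply, h1,
        ← Prod.mk.eta (p := chartDeriv x x u), h1] at this
      simpa [show ((0 : E), (0 : E)) = 0 from rfl] using this
    exact (chartDeriv_bijective hx).1 ((Prod.ext h1 h2).trans (map_zero _).symm)
  exact ⟨hleft, fun u h => hleft u fun w => by rw [cartanTwoForm_neg hL, h w, neg_zero]⟩

/-- The forces of Chetaev type do not contribute to the vertical part of the dynamics. -/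
theorem S_eq_liouville_of_cartanTwoForm (hL : ContMDiff (IT E) 𝓘(ℝ, ℝ) ∞ L)
    (hLreg : IsRegularLagrangian L) (x : TQ E Q) (u : TTQ x) (μ : Module.Dual ℝ (TTQ x))
    (h : ∀ w, cartanTwoForm L x u w + μ (S x w) = diff (energy L) x w) :
    S x u = liouville x := by
  rw [← sub_eq_zero]
  refine (cartanTwoForm_nondegenerate hL hLreg x).1 _ fun w => ?_
  -- On vectors S w the multiplier term is μ(S² w) = 0.
  have h1 := h (S x w)
  rw [S_S, map_zero, add_zero] at h1
  rw [map_sub, LinearMap.sub_apply, cartanTwoForm_S hL, cartanTwoForm_liouville hL, h1, sub_self]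

end LagrangianInCharts

/-! ### Inverting the symplectic form -/

section CartanForm

variable {E : Type*} [NormedAddCommGroup E] [NormedSpace ℝ E] [FiniteDimensional ℝ E]
  {Q : Type*} [TopologicalSpace Q] [ChartedSpace E Q] [IsManifold 𝓘(ℝ, E) ∞ Q]
  {L : TQ E Q → ℝ}

theorem cartanTwoForm_cartanInv (hL : ContMDiff (IT E) 𝓘(ℝ, ℝ) ∞ L)
    (hLreg : IsRegularLagrangian L) (x : TQ E Q) (α : Module.Dual ℝ (TTQ x)) (w : TTQ x) :
    cartanTwoForm L x (cartanInv L x α) w = α w := by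
  rw [cartanInv, dif_pos (cartanTwoForm_nondegenerate hL hLreg x)]
  exact LinearMap.BilinForm.apply_toDual_symm_apply _ _

theorem cartanTwoForm_eulerLagrange (hL : ContMDiff (IT E) 𝓘(ℝ, ℝ) ∞ L)
    (hLreg : IsRegularLagrangian L) (x : TQ E Q) (w : TTQ x) :
    cartanTwoForm L x (eulerLagrange L x) w = diff (energy L) x w :=
  cartanTwoForm_cartanInv hL hLreg x _ w

end CartanForm

/-! ### The multiplier system as a smooth family of operators in charts -/

section LagrangeOperator

variable {E : Type*} [NormedAddCommGroup E] [NormedSpace ℝ E]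
  {Q : Type*} [TopologicalSpace Q] [ChartedSpace E Q] [IsManifold 𝓘(ℝ, E) ∞ Q]
  {G : Type*} [NormedAddCommGroup G] [NormedSpace ℝ G]
  {C : Type*} [TopologicalSpace C] [ChartedSpace G C]

/-- The Cartan 2-form in coordinates, as a family of continuous bilinear forms. -/
def twoFormCLM (L : TQ E Q → ℝ) (x₀ : TQ E Q) (z : E × E) : E × E →L[ℝ] E × E →L[ℝ] ℝ :=
  (fderiv ℝ (fderiv ℝ (inChart L x₀)) z).comp (verticalEndo E) -
    ((ContinuousLinearMap.compL ℝ (E × E) (E × E) ℝ).flip (verticalEndo E)).comp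
      (fderiv ℝ (fderiv ℝ (inChart L x₀)) z)

/-- The operator `(g, μ) ↦ (ω (A g) + μ ∘ S, μ ∘ A)` of the Lagrange multiplier system, in
coordinates: `y` is the point of the chart of `TQ` and `A` is the derivative of the inclusion. -/
def lagrangeOp (L : TQ E Q → ℝ) (x₀ : TQ E Q) (y : E × E) (A : G →L[ℝ] E × E) :
    G × (E × E →L[ℝ] ℝ) →L[ℝ] (E × E →L[ℝ] ℝ) × (G →L[ℝ] ℝ) :=
  (ContinuousLinearMap.inl ℝ _ _).comp (((twoFormCLM L x₀ y).comp A).comp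
      (ContinuousLinearMap.fst ℝ _ _) +
    ((ContinuousLinearMap.compL ℝ (E × E) (E × E) ℝ).flip (verticalEndo E)).comp
      (ContinuousLinearMap.snd ℝ _ _)) +
  (ContinuousLinearMap.inr ℝ _ _).comp (((ContinuousLinearMap.compL ℝ G (E × E) ℝ).flip A).comp
      (ContinuousLinearMap.snd ℝ _ _))

/-- The expression of a map `C → TQ` in charts. -/
def mapInCharts (ι : C → TQ E Q) (c₀ : C) : G → E × E :=
  extChartAt (IT E) (ι c₀) ∘ ι ∘ (extChartAt 𝓘(ℝ, G) c₀).symm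

variable (G) in
/-- The derivative at `c` of the chart of `C` around `c₀`. -/
def constraintChartDeriv (c₀ c : C) : TangentSpace 𝓘(ℝ, G) c →L[ℝ] G :=
  mfderiv 𝓘(ℝ, G) 𝓘(ℝ, G) (extChartAt 𝓘(ℝ, G) c₀) c

variable {L : TQ E Q → ℝ} {ι : C → TQ E Q} {c₀ c : C}

/-- The first terms of the two expressions have their arguments in opposite order; symmetry of D²L
reconciles them. -/
theorem twoFormCLM_apply (hL : ContMDiff (IT E) 𝓘(ℝ, ℝ) ∞ L) {x₀ : TQ E Q} {z : E × E}
    (hz : z ∈ (extChartAt (IT E) x₀).target) (u w : E × E) :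
    twoFormCLM L x₀ z u w = twoFormInChart L x₀ z u w := by
  rw [twoFormInChart, fderiv_fderiv_inChart_symm hL hz w]
  rfl

theorem lagrangeOp_apply (x₀ : TQ E Q) (y : E × E) (A : G →L[ℝ] E × E) (g : G)
    (μ : E × E →L[ℝ] ℝ) :
    lagrangeOp L x₀ y A (g, μ) =
      (twoFormCLM L x₀ y (A g) + μ.comp (verticalEndo E), μ.comp A) := by
  simp [lagrangeOp]

theorem contDiffAt_twoFormCLM (hL : ContMDiff (IT E) 𝓘(ℝ, ℝ) ∞ L) {x₀ : TQ E Q} {z : E × E}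
    (hz : z ∈ (extChartAt (IT E) x₀).target) : ContDiffAt ℝ ∞ (twoFormCLM L x₀) z := by
  have h : ContDiffAt ℝ ∞ (fderiv ℝ (fderiv ℝ (inChart L x₀))) z :=
    (contDiffAt_fderiv_inChart hL hz).fderiv_right (by simp)
  exact (h.clm_comp contDiffAt_const).sub (contDiffAt_const.clm_comp h)

theorem contDiffAt_lagrangeOp (hL : ContMDiff (IT E) 𝓘(ℝ, ℝ) ∞ L) {x₀ : TQ E Q}
    {y : G → E × E} {A : G → G →L[ℝ] E × E} {z : G} (hyz : y z ∈ (extChartAt (IT E) x₀).target)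
    (hy : ContDiffAt ℝ ∞ y z) (hA : ContDiffAt ℝ ∞ A z) :
    ContDiffAt ℝ ∞ (fun z => lagrangeOp L x₀ (y z) (A z)) z := by
  have h1 : ContDiffAt ℝ ∞ (fun z => twoFormCLM L x₀ (y z)) z :=
    (contDiffAt_twoFormCLM hL hyz).comp z hy
  have hP : ContDiff ℝ ∞ fun A : G →L[ℝ] E × E =>
      (ContinuousLinearMap.compL ℝ G (E × E) ℝ).flip A := by fun_prop
  have h2 : ContDiffAt ℝ ∞ (fun z => (ContinuousLinearMap.compL ℝ G (E × E) ℝ).flip (A z)) z :=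
    hP.contDiffAt.comp z hA
  exact (contDiffAt_const.clm_comp (((h1.clm_comp hA).clm_comp contDiffAt_const).add
    contDiffAt_const)).add (contDiffAt_const.clm_comp (h2.clm_comp contDiffAt_const))

theorem mapInCharts_apply (hc : c ∈ (extChartAt 𝓘(ℝ, G) c₀).source) :
    mapInCharts ι c₀ (extChartAt 𝓘(ℝ, G) c₀ c) = extChartAt (IT E) (ι c₀) (ι c) :=
  congrArg (fun c => extChartAt (IT E) (ι c₀) (ι c)) ((extChartAt 𝓘(ℝ, G) c₀).left_inv hc)

theorem IsRegularSystem.S_eq_zero (hreg : IsRegularSystem G L ι) (c : C) (u : TTQ (ι c))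
    (hu : ∀ w ∈ LinearMap.range (mfderiv 𝓘(ℝ, G) (IT E) ι c).toLinearMap,
      cartanTwoForm L (ι c) u w = 0)
    (hSu : S (ι c) u ∈ LinearMap.range (mfderiv 𝓘(ℝ, G) (IT E) ι c).toLinearMap) :
    S (ι c) u = 0 := by
  have h : S (ι c) u ∈ distributionS G L ι c ⊓ tangent G ι c := ⟨⟨u, hu, rfl⟩, hSu⟩
  rwa [hreg c, Submodule.mem_bot] at h

variable [IsManifold 𝓘(ℝ, G) ∞ C]

theorem contDiffAt_mapInCharts (hι : ContMDiff 𝓘(ℝ, G) (IT E) ∞ ι)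
    (hc : c ∈ (extChartAt 𝓘(ℝ, G) c₀).source) (hx : ι c ∈ (extChartAt (IT E) (ι c₀)).source) :
    ContDiffAt ℝ ∞ (mapInCharts ι c₀) (extChartAt 𝓘(ℝ, G) c₀ c) := by
  rw [← contMDiffAt_iff_contDiffAt]
  have h1 : ContMDiffAt 𝓘(ℝ, G) 𝓘(ℝ, G) ∞ (extChartAt 𝓘(ℝ, G) c₀).symm
      (extChartAt 𝓘(ℝ, G) c₀ c) := (contMDiffOn_extChartAt_symm c₀).contMDiffAt
    ((isOpen_extChartAt_target c₀).mem_nhds ((extChartAt 𝓘(ℝ, G) c₀).map_source hc))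
  refine ContMDiffAt.comp (I' := IT E) _ ?_ (hι.contMDiffAt.comp _ h1)
  refine contMDiffAt_extChartAt' ?_
  rw [Function.comp_apply, (extChartAt 𝓘(ℝ, G) c₀).left_inv hc]
  rwa [extChartAt_source] at hx

theorem constraintChartDeriv_bijective (hc : c ∈ (extChartAt 𝓘(ℝ, G) c₀).source) :
    Function.Bijective (constraintChartDeriv G c₀ c) :=
  (isInvertible_mfderiv_extChartAt (I := 𝓘(ℝ, G)) hc).bijective

theorem chartDeriv_mfderiv (hι : ContMDiff 𝓘(ℝ, G) (IT E) ∞ ι)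
    (hc : c ∈ (extChartAt 𝓘(ℝ, G) c₀).source) (hx : ι c ∈ (extChartAt (IT E) (ι c₀)).source)
    (g : TangentSpace 𝓘(ℝ, G) c) :
    chartDeriv (ι c₀) (ι c) (mfderiv 𝓘(ℝ, G) (IT E) ι c g) =
      fderiv ℝ (mapInCharts ι c₀) (extChartAt 𝓘(ℝ, G) c₀ c) (constraintChartDeriv G c₀ c g) := by
  have hφ : MDifferentiableAt (IT E) 𝓘(ℝ, E × E) (extChartAt (IT E) (ι c₀)) (ι c) :=
    mdifferentiableAt_extChartAt (by rwa [extChartAt_source] at hx)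
  have hψ : MDifferentiableAt 𝓘(ℝ, G) 𝓘(ℝ, G) (extChartAt 𝓘(ℝ, G) c₀) c :=
    mdifferentiableAt_extChartAt (by rwa [extChartAt_source] at hc)
  have hm : MDifferentiableAt 𝓘(ℝ, G) 𝓘(ℝ, E × E) (mapInCharts ι c₀) (extChartAt 𝓘(ℝ, G) c₀ c) :=
    ((contDiffAt_mapInCharts hι hc hx).differentiableAt (by simp)).mdifferentiableAt
  have h1 := mfderiv_comp_apply c hφ (hι.mdifferentiableAt (by simp)) g
  have h2 := mfderiv_comp_apply c hm hψ g
  rw [mfderiv_eq_fderiv] at h2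
  have hEq : (extChartAt (IT E) (ι c₀) ∘ ι) =ᶠ[nhds c]
      (mapInCharts ι c₀ ∘ extChartAt 𝓘(ℝ, G) c₀) := by
    filter_upwards [(isOpen_extChartAt_source (I := 𝓘(ℝ, G)) c₀).mem_nhds hc] with d hd
    exact (mapInCharts_apply hd).symm
  exact h1.symm.trans ((DFunLike.congr_fun hEq.mfderiv_eq g).trans h2)

/-- The Lagrange multiplier system in charts. -/
theorem lagrangeOp_apply_eq_iff (hL : ContMDiff (IT E) 𝓘(ℝ, ℝ) ∞ L)
    (hι : ContMDiff 𝓘(ℝ, G) (IT E) ∞ ι)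
    (hc : c ∈ (extChartAt 𝓘(ℝ, G) c₀).source) (hx : ι c ∈ (extChartAt (IT E) (ι c₀)).source)
    (g : TangentSpace 𝓘(ℝ, G) c) (μ β : E × E →L[ℝ] ℝ) :
    lagrangeOp L (ι c₀) (mapInCharts ι c₀ (extChartAt 𝓘(ℝ, G) c₀ c))
        (fderiv ℝ (mapInCharts ι c₀) (extChartAt 𝓘(ℝ, G) c₀ c))
        (constraintChartDeriv G c₀ c g, μ) = (β, 0) ↔
      (∀ w, cartanTwoForm L (ι c) (mfderiv 𝓘(ℝ, G) (IT E) ι c g) w +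
        μ (chartDeriv (ι c₀) (ι c) (S (ι c) w)) = β (chartDeriv (ι c₀) (ι c) w)) ∧
      ∀ g', μ (chartDeriv (ι c₀) (ι c) (mfderiv 𝓘(ℝ, G) (IT E) ι c g')) = 0 := by
  rw [lagrangeOp_apply, Prod.mk.injEq, ← chartDeriv_mfderiv hι hc hx, mapInCharts_apply hc]
  refine and_congr ?_ ?_
  -- Chart derivatives are onto, so equality of coordinate covectors can be tested on images of
  -- tangent vectors.
  · rw [ContinuousLinearMap.ext_iff, (chartDeriv_bijective hx).2.forall]
    refine forall_congr' fun w => ?_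
    rw [cartanTwoForm_eq hL hx, chartDeriv_S hx, add_apply,
      twoFormCLM_apply hL ((extChartAt (IT E) (ι c₀)).map_source hx)]
    rfl
  · rw [ContinuousLinearMap.ext_iff, (constraintChartDeriv_bijective hc).2.forall]
    refine forall_congr' fun g' => ?_
    rw [chartDeriv_mfderiv hι hc hx]
    rfl

end LagrangeOperator

/-! ### Equations of motion, unique solvability and smoothness -/

section Solutions

variable {E : Type*} [NormedAddCommGroup E] [NormedSpace ℝ E] [FiniteDimensional ℝ E]
  {Q : Type*} [TopologicalSpace Q] [ChartedSpace E Q] [IsManifold 𝓘(ℝ, E) ∞ Q]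
  {G : Type*} [NormedAddCommGroup G] [NormedSpace ℝ G]
  {C : Type*} [TopologicalSpace C] [ChartedSpace G C]
  {L : TQ E Q → ℝ} {ι : C → TQ E Q}

theorem poisson_eq (hL : ContMDiff (IT E) 𝓘(ℝ, ℝ) ∞ L) (hLreg : IsRegularLagrangian L)
    (x : TQ E Q) (α β : Module.Dual ℝ (TTQ x)) : poisson L x α β = α (cartanInv L x β) :=
  cartanTwoForm_cartanInv hL hLreg x _ _

/-- The equation of motion `Γ = Γ_L + Λ_L(f)` is `ω_L(Γ) + f = dE_L`. -/
theorem eq_eulerLagrange_add_poisson_iff (hL : ContMDiff (IT E) 𝓘(ℝ, ℝ) ∞ L)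
    (hLreg : IsRegularLagrangian L) (x : TQ E Q) (f : Module.Dual ℝ (TTQ x)) (u : TTQ x) :
    (∀ β : Module.Dual ℝ (TTQ x), β u = β (eulerLagrange L x) + poisson L x f β) ↔
      ∀ w, cartanTwoForm L x u w + f w = diff (energy L) x w := by
  have hβ (β : Module.Dual ℝ (TTQ x)) (w : TTQ x) :
      β w = -cartanTwoForm L x w (cartanInv L x β) := by
    rw [← cartanTwoForm_neg hL, cartanTwoForm_cartanInv hL hLreg]
  have hinv (w : TTQ x) : cartanInv L x (cartanTwoForm L x w) = w := by
    rw [← sub_eq_zero]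
    refine (cartanTwoForm_nondegenerate hL hLreg x).1 _ fun w' => ?_
    rw [map_sub, LinearMap.sub_apply, cartanTwoForm_cartanInv hL hLreg, sub_self]
  constructor
  · intro h w
    -- Test with β = ω_L(w, ·), whose image under the inverse of ω̂_L is `w`.
    have := h (cartanTwoForm L x w)
    rw [poisson_eq hL hLreg, hinv, cartanTwoForm_neg hL x w, cartanTwoForm_neg hL x w,
      cartanTwoForm_eulerLagrange hL hLreg] at this
    linarith
  · intro h β
    have := h (cartanInv L x β)
    rw [poisson_eq hL hLreg, hβ β u, hβ β (eulerLagrange L x),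
      cartanTwoForm_eulerLagrange hL hLreg]
    linarith

/-- The equation of motion of the non-holonomic problem in terms of Lagrange multipliers. -/
theorem dynamics_iff_exists_multiplier (hL : ContMDiff (IT E) 𝓘(ℝ, ℝ) ∞ L)
    (hLreg : IsRegularLagrangian L) (c : C) (u : TTQ (ι c)) :
    (∃ f ∈ chetaevForces G ι c, ∀ β : Module.Dual ℝ (TTQ (ι c)),
      β u = β (eulerLagrange L (ι c)) + poisson L (ι c) f β) ↔
    ∃ μ : Module.Dual ℝ (TTQ (ι c)),
      (∀ w, cartanTwoForm L (ι c) u w + μ (S (ι c) w) = diff (energy L) (ι c) w) ∧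
      ∀ g, μ (mfderiv 𝓘(ℝ, G) (IT E) ι c g) = 0 := by
  simp only [eq_eulerLagrange_add_poisson_iff hL hLreg]
  constructor
  · rintro ⟨_, ⟨μ, hμ, rfl⟩, h⟩
    exact ⟨μ, h, fun g => (Submodule.mem_dualAnnihilator μ).1 hμ _ ⟨g, rfl⟩⟩
  · rintro ⟨μ, h, hμ⟩
    refine ⟨_, ⟨μ, (Submodule.mem_dualAnnihilator μ).2 ?_, rfl⟩, h⟩
    rintro _ ⟨g, rfl⟩
    exact hμ g

theorem multiplier_unique (hL : ContMDiff (IT E) 𝓘(ℝ, ℝ) ∞ L) (hLreg : IsRegularLagrangian L)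
    (hι : IsSubmanifold G ι) (hrank : HasFullRankForces G ι) (hreg : IsRegularSystem G L ι)
    (c : C) {g : TangentSpace 𝓘(ℝ, G) c} {μ : Module.Dual ℝ (TTQ (ι c))}
    (h1 : ∀ w, cartanTwoForm L (ι c) (mfderiv 𝓘(ℝ, G) (IT E) ι c g) w + μ (S (ι c) w) = 0)
    (h2 : ∀ g', μ (mfderiv 𝓘(ℝ, G) (IT E) ι c g') = 0) : g = 0 ∧ μ = 0 :=
  lagrangeSystem_injective (cartanTwoForm L (ι c)) (cartanTwoForm_nondegenerate hL hLreg _)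
    (S (ι c)).toLinearMap (cartanTwoForm_S hL _) (mfderiv 𝓘(ℝ, G) (IT E) ι c).toLinearMap
    (hι.immersion c) (hrank c) (hreg.S_eq_zero c) h1 h2

variable [FiniteDimensional ℝ G]

theorem exists_multiplier (hL : ContMDiff (IT E) 𝓘(ℝ, ℝ) ∞ L) (hLreg : IsRegularLagrangian L)
    (hι : IsSubmanifold G ι) (hrank : HasFullRankForces G ι) (hreg : IsRegularSystem G L ι)
    (c : C) : ∃ (g : TangentSpace 𝓘(ℝ, G) c) (μ : Module.Dual ℝ (TTQ (ι c))),
      (∀ w, cartanTwoForm L (ι c) (mfderiv 𝓘(ℝ, G) (IT E) ι c g) w + μ (S (ι c) w) =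
        diff (energy L) (ι c) w) ∧ ∀ g', μ (mfderiv 𝓘(ℝ, G) (IT E) ι c g') = 0 :=
  haveI : FiniteDimensional ℝ (TangentSpace 𝓘(ℝ, G) c) :=
    inferInstanceAs (FiniteDimensional ℝ G)
  exists_lagrangeSystem (cartanTwoForm L (ι c)) (cartanTwoForm_nondegenerate hL hLreg _)
    (S (ι c)).toLinearMap (cartanTwoForm_S hL _) (mfderiv 𝓘(ℝ, G) (IT E) ι c).toLinearMap
    (hι.immersion c) (hrank c) (hreg.S_eq_zero c) (diff (energy L) (ι c)).toLinearMap

theorem finrank_continuousDual (V : Type*) [NormedAddCommGroup V] [NormedSpace ℝ V]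
    [FiniteDimensional ℝ V] : Module.finrank ℝ (V →L[ℝ] ℝ) = Module.finrank ℝ V := by
  rw [← (LinearMap.toContinuousLinearMap (𝕜 := ℝ) (E := V) (F' := ℝ)).finrank_eq]
  exact Subspace.dual_finrank_eq

theorem isInvertible_of_injective {V W : Type*} [NormedAddCommGroup V] [NormedSpace ℝ V]
    [NormedAddCommGroup W] [NormedSpace ℝ W] [FiniteDimensional ℝ V] [FiniteDimensional ℝ W]
    (f : V →L[ℝ] W) (hf : Function.Injective f)
    (h : Module.finrank ℝ V = Module.finrank ℝ W) : f.IsInvertible :=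
  ⟨(LinearMap.linearEquivOfInjective f.toLinearMap hf h).toContinuousLinearEquiv, rfl⟩

variable [IsManifold 𝓘(ℝ, G) ∞ C]

theorem isInvertible_lagrangeOp (hL : ContMDiff (IT E) 𝓘(ℝ, ℝ) ∞ L)
    (hLreg : IsRegularLagrangian L) (hι : IsSubmanifold G ι) (hrank : HasFullRankForces G ι)
    (hreg : IsRegularSystem G L ι) {c₀ c : C} (hc : c ∈ (extChartAt 𝓘(ℝ, G) c₀).source)
    (hx : ι c ∈ (extChartAt (IT E) (ι c₀)).source) :
    (lagrangeOp L (ι c₀) (mapInCharts ι c₀ (extChartAt 𝓘(ℝ, G) c₀ c))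
      (fderiv ℝ (mapInCharts ι c₀) (extChartAt 𝓘(ℝ, G) c₀ c))).IsInvertible := by
  refine isInvertible_of_injective _ ((injective_iff_map_eq_zero _).2 ?_) ?_
  · rintro ⟨g, μ⟩ h
    obtain ⟨g, rfl⟩ := (constraintChartDeriv_bijective hc).2 g
    obtain ⟨h1, h2⟩ := (lagrangeOp_apply_eq_iff hL hι.contMDiff hc hx g μ 0).1 h
    obtain ⟨rfl, h3⟩ := multiplier_unique hL hLreg hι hrank hreg c
      (μ := μ.toLinearMap ∘ₗ (chartDeriv (ι c₀) (ι c)).toLinearMap) h1 h2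
    refine Prod.ext (map_zero _) (ContinuousLinearMap.ext fun w => ?_)
    obtain ⟨w, rfl⟩ := (chartDeriv_bijective hx).2 w
    exact LinearMap.congr_fun h3 w
  · rw [Module.finrank_prod, Module.finrank_prod, finrank_continuousDual, finrank_continuousDual, add_comm]

/-- The solution of the Lagrange multiplier system depends smoothly on the point of `C`. -/
theorem contMDiff_of_multiplier (hL : ContMDiff (IT E) 𝓘(ℝ, ℝ) ∞ L)
    (hLreg : IsRegularLagrangian L) (hι : IsSubmanifold G ι) (hrank : HasFullRankForces G ι)
    (hreg : IsRegularSystem G L ι) (g : ∀ c : C, TangentSpace 𝓘(ℝ, G) c)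
    (hg : ∀ c : C, ∃ μ : Module.Dual ℝ (TTQ (ι c)),
      (∀ w, cartanTwoForm L (ι c) (mfderiv 𝓘(ℝ, G) (IT E) ι c (g c)) w + μ (S (ι c) w) =
        diff (energy L) (ι c) w) ∧ ∀ g', μ (mfderiv 𝓘(ℝ, G) (IT E) ι c g') = 0) :
    ContMDiff 𝓘(ℝ, G) (IT E).tangent ∞ (fun c => (⟨ι c, mfderiv 𝓘(ℝ, G) (IT E) ι c (g c)⟩ :
      TangentBundle (IT E) (TQ E Q))) := by
  intro c₀
  set φ := extChartAt (IT E) (ι c₀)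
  set ψ := extChartAt 𝓘(ℝ, G) c₀
  set m : G → E × E := mapInCharts ι c₀
  -- The candidate coordinate expression of Γ. `inverse` is zero on non-invertible operators, so γ
  -- is defined everywhere; only its values near `ψ c₀` matter.
  let γ : G → E × E := fun z => fderiv ℝ m z ((lagrangeOp L (ι c₀) (m z) (fderiv ℝ m z)).inverse
    (fderiv ℝ (energyInChart L (ι c₀)) (m z), 0)).1
  have hc₀ : c₀ ∈ ψ.source := mem_extChartAt_source c₀
  have hx₀ : ι c₀ ∈ φ.source := mem_extChartAt_source (ι c₀)
  have hmz : m (ψ c₀) ∈ φ.target := by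
    rw [show m (ψ c₀) = φ (ι c₀) from mapInCharts_apply hc₀]
    exact φ.map_source hx₀
  have hγ : ContDiffAt ℝ ∞ γ (ψ c₀) := by
    have hm : ContDiffAt ℝ ∞ m (ψ c₀) := contDiffAt_mapInCharts hι.contMDiff hc₀ hx₀
    have hA : ContDiffAt ℝ ∞ (fderiv ℝ m) (ψ c₀) := hm.fderiv_right (by simp)
    obtain ⟨e, he⟩ := isInvertible_lagrangeOp hL hLreg hι hrank hreg hc₀ hx₀
    have hinv : ContDiffAt ℝ ∞ (fun z => (lagrangeOp L (ι c₀) (m z) (fderiv ℝ m z)).inverse)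
        (ψ c₀) := by
      refine ContDiffAt.comp (g := ContinuousLinearMap.inverse) (ψ c₀) ?_
        (contDiffAt_lagrangeOp hL hmz hm hA)
      have := contDiffAt_map_inverse (n := ∞) e
      rwa [he] at this
    have hE : ContDiffAt ℝ ∞ (fun z => fderiv ℝ (energyInChart L (ι c₀)) (m z)) (ψ c₀) :=
      ((contDiffAt_energyInChart hL hmz).fderiv_right (by simp)).comp (ψ c₀) hm
    exact hA.clm_apply (hinv.clm_apply (hE.prodMk contDiffAt_const)).fst
  have heq : ∀ᶠ c in nhds c₀, c ∈ ψ.source ∧ ι c ∈ φ.source :=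
    Filter.Eventually.and (extChartAt_source_mem_nhds c₀)
      (hι.contMDiff.continuous.continuousAt.eventually (extChartAt_source_mem_nhds (ι c₀)))
  refine Bundle.contMDiffAt_totalSpace.2 ⟨hι.contMDiff.contMDiffAt, ?_⟩
  refine (hγ.contMDiffAt.comp c₀ (contMDiffAt_extChartAt (x := c₀))).congr_of_eventuallyEq ?_
  filter_upwards [heq] with c ⟨hc, hx⟩
  obtain ⟨μ, h1, h2⟩ := hg c
  let T := LinearEquiv.ofBijective (chartDeriv (ι c₀) (ι c)).toLinearMap (chartDeriv_bijective hx)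
  -- The multiplier μ, transported to the model space so that it can be fed to the operator in
  -- charts.
  let ν : E × E →L[ℝ] ℝ := LinearMap.toContinuousLinearMap (μ ∘ₗ T.symm.toLinearMap)
  have hν (u : TTQ (ι c)) : ν (chartDeriv (ι c₀) (ι c) u) = μ u :=
    congrArg μ (T.symm_apply_apply u)
  have hsys := (lagrangeOp_apply_eq_iff hL hι.contMDiff hc hx (g c) ν
    (fderiv ℝ (energyInChart L (ι c₀)) (φ (ι c)))).2
      ⟨fun w => by rw [hν, h1, diff_energy_eq hL hx], fun g' => by rw [hν, h2]⟩
  have hsol : γ (ψ c) = chartDeriv (ι c₀) (ι c) (mfderiv 𝓘(ℝ, G) (IT E) ι c (g c)) := by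
    have hinv := isInvertible_lagrangeOp hL hLreg hι hrank hreg hc hx
    rw [chartDeriv_mfderiv hι.contMDiff hc hx]
    simp only [γ]
    rw [show m (ψ c) = φ (ι c) from mapInCharts_apply hc, ← hsys, mapInCharts_apply hc]
    rw [mapInCharts_apply hc] at hinv
    rw [hinv.inverse_apply_self]
  have hx' : ι c ∈ (chartAt (ModelProd E E) (ι c₀)).source := by
    rwa [← extChartAt_source (IT E)]
  -- The fibre coordinate of a vector in T(TQ) is its image under the derivative of the chart of TQ,
  -- which is what γ computes.
  have htriv := (congrFun (Bundle.Trivialization.coe_linearMapAt_of_mem (R := ℝ)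
    (trivializationAt (E × E) (TangentSpace (IT E) : TQ E Q → Type _) (ι c₀)) hx')
      (mfderiv 𝓘(ℝ, G) (IT E) ι c (g c))).symm.trans
    (DFunLike.congr_fun (TangentBundle.continuousLinearMapAt_trivializationAt (I := IT E) hx')
      (mfderiv 𝓘(ℝ, G) (IT E) ι c (g c)))
  exact htriv.trans hsol.symm

end Solutions

end NonHolonomic

end

/-! ### The main theorem -/

theorem mainTheorem3
    {E : Type*} [NormedAddCommGroup E] [NormedSpace ℝ E] [FiniteDimensional ℝ E]
    {Q : Type*} [TopologicalSpace Q] [ChartedSpace E Q] [IsManifold 𝓘(ℝ, E) ∞ Q]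
    {G : Type*} [NormedAddCommGroup G] [NormedSpace ℝ G] [FiniteDimensional ℝ G]
    {C : Type*} [TopologicalSpace C] [ChartedSpace G C] [IsManifold 𝓘(ℝ, G) ∞ C]
    (L : NonHolonomic.TQ E Q → ℝ)
    (hL : ContMDiff (NonHolonomic.IT E) 𝓘(ℝ, ℝ) ∞ L)
    (hLreg : NonHolonomic.IsRegularLagrangian L)
    (ι : C → NonHolonomic.TQ E Q)
    (hι : NonHolonomic.IsSubmanifold G ι)
    (hrank : NonHolonomic.HasFullRankForces G ι)
    (hreg : NonHolonomic.IsRegularSystem G L ι) :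
    (∃! Γ : ∀ c : C, NonHolonomic.TTQ (ι c), NonHolonomic.IsSolution G L ι Γ) ∧
      ∀ Γ : ∀ c : C, NonHolonomic.TTQ (ι c),
        NonHolonomic.IsSolution G L ι Γ → NonHolonomic.IsSODE ι Γ := by
  open NonHolonomic in
  have hsode : ∀ Γ, IsSolution G L ι Γ → IsSODE ι Γ := fun Γ hΓ c => by
    obtain ⟨μ, h, -⟩ := (dynamics_iff_exists_multiplier hL hLreg c (Γ c)).1 (hΓ.dynamics c)
    exact S_eq_liouville_of_cartanTwoForm hL hLreg (ι c) (Γ c) μ h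
  refine ⟨?_, hsode⟩
  -- A pointwise choice suffices: the system determines `g c`, so the chosen field agrees locally
  -- with the smooth expression obtained by inverting the operator.
  choose g hg using NonHolonomic.exists_multiplier hL hLreg hι hrank hreg
  refine ⟨fun c => mfderiv 𝓘(ℝ, G) (NonHolonomic.IT E) ι c (g c), ⟨?_, fun c => ?_, fun c => ?_⟩, ?_⟩
  · exact NonHolonomic.contMDiff_of_multiplier hL hLreg hι hrank hreg g hg
  · exact (NonHolonomic.dynamics_iff_exists_multiplier hL hLreg c _).2 (hg c)
  · exact ⟨g c, rfl⟩
  · intro Γ hΓ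
    funext c
    obtain ⟨g', hg'⟩ := hΓ.tangent c
    obtain ⟨μ, h1, h2⟩ :=
      (NonHolonomic.dynamics_iff_exists_multiplier hL hLreg c (Γ c)).1 (hΓ.dynamics c)
    obtain ⟨ν, h3, h4⟩ := hg c
    rw [← hg'] at h1
    -- The difference of two solutions, with their multipliers, solves the homogeneous system.
    have h := (NonHolonomic.multiplier_unique hL hLreg hι hrank hreg c (g := g' - g c)
      (μ := μ - ν) (fun w => ?_) (fun w => ?_)).1
    · rw [← hg', sub_eq_zero.1 h]
      rfl
    · have h5 := h1 w
      have h6 := h3 w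
      rw [map_sub, map_sub, LinearMap.sub_apply, LinearMap.sub_apply, sub_add_sub_comm]
      exact sub_eq_zero.2 (h5.trans h6.symm)
    · rw [LinearMap.sub_apply, h2, h4, sub_zero]
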